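/- Let $d\ge 3$ be an odd integer, let $X=\{1,\dots,d\}$, and let $T$ be the $d$-regular rooted tree whose vertices are the words over $X$, the children of a word $u$ being the words $ux$ with $x\in X$. Let $\operatorname{Aut}(T)$ be the group of root-preserving graph automorphisms of $T$, with product $(gh)(u)=h(g(u))$. With indices read modulo $d$ in $\{1,\dots,d\}$, let $a_1,\dots,a_d\in\operatorname{Aut}(T)$ be the automorphisms given recursively, for $x \in X$ and every word $v$ over $X$, by $$a_i(xv)=\begin{cases}(i+1)\,a_i(v), & x=i,\\ i\,a_{i+1}(v), & x=i+1,\\ xv, & \text{otherwise,}\end{cases}$$ and let $G_d=\langle a_1,\dots,a_d\rangle\le\operatorname{Aut}(T)$. Then the subsemigroup of $G_d$ generated by $a_1,\dots,a_d$, together with the identity (the empty product), is a trace monoid (free partially commutative monoid). More precisely, this submonoid has the monoid presentation $$\langle a_1,\dots,a_d \;:\; a_ia_j=a_ja_i \text{ for } 1<|j-i|<d-1\rangle ,$$ that is, the homomorphism from the presented monoid to $G_d$ sending each generator $a_i$ to the automorphism $a_i$ is injective. Moreover, the subsemigroup generated by $a_1,\dots,a_d$ without adjoining the identity is exactly the image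 of the set of non-identity elements of the presented monoid. -/

import Mathlib

/-- The regular rooted tree over the alphabet `X`: its vertices are the words over `X`, and the
children of a word `u` are the words `u ++ [x]` with `x : X`. -/
def wordTree (X : Type*) : SimpleGraph (List X) where
  Adj u v := (∃ x, v = u ++ [x]) ∨ (∃ x, u = v ++ [x])
  symm := ⟨fun _ _ h => h.symm⟩
  loopless := ⟨fun u h => by
    rcases h with ⟨x, h⟩ | ⟨x, h⟩ <;> simpa using congrArg List.length h⟩

/-- `Aut(T)`: the graph automorphisms of the rooted tree over `X` that fix the root. -/
structure TreeAut (X : Type*) where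
  toIso : wordTree X ≃g wordTree X
  map_root : toIso [] = []

namespace TreeAut

variable {X : Type*}

instance : CoeFun (TreeAut X) (fun _ => List X → List X) := ⟨fun g => g.toIso⟩

theorem ext' {g h : TreeAut X} (H : ∀ u, g u = h u) : g = h := by
  cases g; cases h
  congr 1
  exact RelIso.ext H

/-- The product is composition from left to right: `(g * h) u = h (g u)`. -/
instance : Mul (TreeAut X) :=
  ⟨fun g h => ⟨g.toIso.trans h.toIso, by simp [g.map_root, h.map_root]⟩⟩

instance : One (TreeAut X) := ⟨⟨RelIso.refl _, rfl⟩⟩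

instance : Inv (TreeAut X) :=
  ⟨fun g => ⟨g.toIso.symm, by
    have h := g.toIso.symm_apply_apply []
    rwa [g.map_root] at h⟩⟩

theorem mul_apply (g h : TreeAut X) (u : List X) : (g * h) u = h (g u) := rfl

theorem one_apply (u : List X) : (1 : TreeAut X) u = u := rfl

instance : Group (TreeAut X) where
  mul_assoc _ _ _ := ext' fun _ => rfl
  one_mul _ := ext' fun _ => rfl
  mul_one _ := ext' fun _ => rfl
  inv_mul_cancel g := ext' fun u => g.toIso.apply_symm_apply u

end TreeAut

namespace Gd

variable {d : ℕ}

/-- The cyclic successor `i ↦ i + 1 (mod d)`. -/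
def next (i : Fin d) : Fin d := ⟨(i.val + 1) % d, Nat.mod_lt _ i.pos⟩

/-- The action on words of `a_i = (e, …, e, a_i, a_{i+1}, e, …, e) (i  i+1)`, indices mod `d`:
the first letter `x` is permuted by the transposition `(i  i+1)`, and the remaining word is acted
upon by the section at `x`, which is `a_i` if `x = i`, `a_{i+1}` if `x = i + 1`, and `e` otherwise. -/
def act : Fin d → List (Fin d) → List (Fin d)
  | _, [] => []
  | i, x :: v => Equiv.swap i (next i) x ::
      (if x = i then act i v else if x = next i then act (next i) v else v)

/-- The inverse of `act i`. -/
def actInv : Fin d → List (Fin d) → List (Fin d)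
  | _, [] => []
  | i, y :: v => Equiv.swap i (next i) y ::
      (if Equiv.swap i (next i) y = i then actInv i v
       else if Equiv.swap i (next i) y = next i then actInv (next i) v else v)

theorem actInv_act (i : Fin d) (u : List (Fin d)) : actInv i (act i u) = u := by
  induction u generalizing i with
  | nil => rfl
  | cons x v ih =>
    simp only [act, actInv, Equiv.swap_apply_self]
    split_ifs <;> simp [ih]

theorem act_actInv (i : Fin d) (u : List (Fin d)) : act i (actInv i u) = u := by
  induction u generalizing i with
  | nil => rfl
  | cons x v ih =>
    simp only [act, actInv, Equiv.swap_apply_self]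
    split_ifs <;> simp [ih]

theorem act_append_singleton (i : Fin d) (u : List (Fin d)) (x : Fin d) :
    ∃ y, act i (u ++ [x]) = act i u ++ [y] := by
  induction u generalizing i with
  | nil => exact ⟨Equiv.swap i (next i) x, by simp [act]⟩
  | cons z v ih =>
    simp only [List.cons_append, act]
    split_ifs
    · obtain ⟨y, hy⟩ := ih i
      exact ⟨y, by rw [hy]⟩
    · obtain ⟨y, hy⟩ := ih (next i)
      exact ⟨y, by rw [hy]⟩
    · exact ⟨x, rfl⟩

theorem actInv_append_singleton (i : Fin d) (u : List (Fin d)) (x : Fin d) :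
    ∃ y, actInv i (u ++ [x]) = actInv i u ++ [y] := by
  induction u generalizing i with
  | nil => exact ⟨Equiv.swap i (next i) x, by simp [actInv]⟩
  | cons z v ih =>
    simp only [List.cons_append, actInv]
    split_ifs
    · obtain ⟨y, hy⟩ := ih i
      exact ⟨y, by rw [hy]⟩
    · obtain ⟨y, hy⟩ := ih (next i)
      exact ⟨y, by rw [hy]⟩
    · exact ⟨x, rfl⟩

/-- The automorphism `a_i` of the `d`-regular rooted tree. -/
def a (i : Fin d) : TreeAut (Fin d) where
  toIso :=
    { toFun := act i
      invFun := actInv i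
      left_inv := actInv_act i
      right_inv := act_actInv i
      map_rel_iff' := by
        intro u v
        change (wordTree (Fin d)).Adj (act i u) (act i v) ↔ (wordTree (Fin d)).Adj u v
        constructor
        · rintro (⟨x, h⟩ | ⟨x, h⟩)
          · obtain ⟨y, hy⟩ := actInv_append_singleton i (act i u) x
            rw [← h, actInv_act, actInv_act] at hy
            exact Or.inl ⟨y, hy⟩
          · obtain ⟨y, hy⟩ := actInv_append_singleton i (act i v) x
            rw [← h, actInv_act, actInv_act] at hy
            exact Or.inr ⟨y, hy⟩
        · rintro (⟨x, rfl⟩ | ⟨x, rfl⟩)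
          · exact Or.inl (act_append_singleton i u x)
          · exact Or.inr (act_append_singleton i v x) }
  map_root := rfl

variable (d)

/-- The group `G_d ≤ Aut(T)` generated by `a_1, …, a_d`. -/
def G : Subgroup (TreeAut (Fin d)) := Subgroup.closure (Set.range a)

/-- The generator `a_i` as an element of `G_d`. -/
def gen (i : Fin d) : G d := ⟨a i, Subgroup.subset_closure ⟨i, rfl⟩⟩

/-- The commutation graph: `i` and `j` are joined iff `1 < |j - i| < d - 1`. -/
def commGraph : SimpleGraph (Fin d) where
  Adj i j := 1 < |(j : ℤ) - (i : ℤ)| ∧ |(j : ℤ) - (i : ℤ)| < (d : ℤ) - 1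
  symm := ⟨fun i j h => by rwa [abs_sub_comm] at h⟩
  loopless := ⟨fun i h => by simp at h⟩

end Gd

/-- The relations `p q = q p` for adjacent vertices `p`, `q` of a graph. -/
def commRels {α : Type*} (Γ : SimpleGraph α) (u v : FreeMonoid α) : Prop :=
  ∃ p q, Γ.Adj p q ∧ u = FreeMonoid.of p * FreeMonoid.of q ∧
    v = FreeMonoid.of q * FreeMonoid.of p

/-- The trace monoid (free partially commutative monoid) with commutation graph `Γ`:
`⟨α : p q = q p for p, q adjacent in Γ⟩`. -/
abbrev TraceMonoid {α : Type*} (Γ : SimpleGraph α) : Type _ := PresentedMonoid (commRels Γ)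

namespace Gd

variable {d : ℕ}

/-! Put a walker on each vertex of the `d`-cycle and let the letter `i` swap the walkers on the edge
`{i, i+1}`. By the wreath recursion `wordAct_cons`, the section of a word at `x` spells the vertices
that walker `x` leaves. A section is no longer than its word. Its consecutive letters are neighbours
on the cycle, so no commutation applies to it and it is the only word with its trace (`isChain_sec`,
`eq_of_tr_eq`). Conversely, the trajectories of all walkers determine the trace of a word
(`tr_eq_of_traj_eq`).

If `u` and `v` act equally, so do their sections at each `x`. Nonempty sections both begin with `x`;
cancelling it and inducting on total length, the tails have equal traces, hence are equal words. If
one section is empty, `eq_nil_of_wordAct_eq` empties the other. So all trajectories agree, and `u`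
and `v` have the same trace. -/

theorem next_val (i : Fin d) :
    (next i).val = if i.val + 1 = d then 0 else i.val + 1 := by
  have := i.isLt
  unfold next
  split_ifs with h
  · simp [h]
  · exact Nat.mod_eq_of_lt (by omega)

theorem next_ne (hd : 3 ≤ d) (i : Fin d) : next i ≠ i := by
  intro h
  have := congrArg Fin.val h
  rw [next_val] at this
  have := i.isLt
  split_ifs at * <;> omega

theorem next_next_ne (hd : 3 ≤ d) (i : Fin d) : next (next i) ≠ i := by
  intro h
  have := congrArg Fin.val h
  rw [next_val, next_val] at this
  have := i.isLt
  split_ifs at * <;> omega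

theorem next_injective : Function.Injective (next : Fin d → Fin d) := by
  intro i j h
  have h := congrArg Fin.val h
  rw [next_val, next_val] at h
  have := i.isLt
  have := j.isLt
  apply Fin.ext
  split_ifs at h <;> omega

theorem commGraph_adj_iff (hd : 3 ≤ d) (i j : Fin d) :
    (commGraph d).Adj i j ↔ i ≠ j ∧ j ≠ next i ∧ i ≠ next j := by
  change (1 < |(j : ℤ) - (i : ℤ)| ∧ |(j : ℤ) - (i : ℤ)| < (d : ℤ) - 1) ↔ _
  simp only [ne_eq, Fin.ext_iff, next_val]
  have := i.isLt
  have := j.isLt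
  rcases abs_cases ((j : ℤ) - (i : ℤ)) with ⟨h, _⟩ | ⟨h, _⟩ <;> rw [h] <;>
    split_ifs <;> omega

/-! ### Walkers and sections of words -/

/-- The edge permutation underlying `a_i`. -/
abbrev sw (i : Fin d) : Equiv.Perm (Fin d) := Equiv.swap i (next i)

/-- The final position of a walker starting at `x` that is moved by the letters of a word. -/
def dest : List (Fin d) → Fin d → Fin d
  | [], x => x
  | i :: w, x => dest w (sw i x)

/-- The section of a word at `x`: the list of positions that a walker starting at `x` leaves. -/
def sec : List (Fin d) → Fin d → List (Fin d)
  | [], _ => []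
  | i :: w, x => if x = i ∨ x = next i then x :: sec w (sw i x) else sec w x

/-- The action of a word in the generators, letters acting from left to right. -/
def wordAct : List (Fin d) → List (Fin d) → List (Fin d)
  | [], u => u
  | i :: w, u => wordAct w (act i u)

theorem sw_of_not {i x : Fin d} (h : ¬(x = i ∨ x = next i)) : sw i x = x :=
  Equiv.swap_apply_of_ne_of_ne (fun e => h (.inl e)) (fun e => h (.inr e))

theorem act_surjective (i : Fin d) : Function.Surjective (act i) :=
  Function.RightInverse.surjective (act_actInv i)

theorem wordAct_cons (w : List (Fin d)) (x : Fin d) (v : List (Fin d)) :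
    wordAct w (x :: v) = dest w x :: wordAct (sec w x) v := by
  induction w generalizing x v with
  | nil => rfl
  | cons i w ih =>
    simp only [wordAct, act, dest, sec, ih]
    by_cases h1 : x = i
    · subst h1; simp [wordAct]
    · by_cases h2 : x = next i
      · subst h2; simp [h1, wordAct]
      · simp [h1, h2, sw_of_not]

theorem dest_eq_of_wordAct_eq {u v : List (Fin d)} (h : wordAct u = wordAct v) (x : Fin d) :
    dest u x = dest v x := by
  have := congrFun h [x]
  simp only [wordAct_cons, List.cons.injEq] at this
  exact this.1

theorem wordAct_sec_eq {u v : List (Fin d)} (h : wordAct u = wordAct v) (x : Fin d) :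
    wordAct (sec u x) = wordAct (sec v x) := by
  funext t
  have := congrFun h (x :: t)
  simp only [wordAct_cons, List.cons.injEq] at this
  exact this.2

theorem wordAct_cancel {i : Fin d} {u v : List (Fin d)}
    (h : wordAct (i :: u) = wordAct (i :: v)) : wordAct u = wordAct v := by
  funext t
  obtain ⟨s, rfl⟩ := act_surjective i t
  exact congrFun h s

theorem length_sec_le (w : List (Fin d)) (x : Fin d) : (sec w x).length ≤ w.length := by
  induction w generalizing x with
  | nil => simp [sec]
  | cons i w ih =>
    rw [sec]
    split_ifs
    · simpa using ih _
    · simpa using (ih x).trans (Nat.le_succ _)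

theorem sec_eq_nil_or (w : List (Fin d)) (x : Fin d) : sec w x = [] ∨ ∃ t, sec w x = x :: t := by
  induction w generalizing x with
  | nil => simp [sec]
  | cons i w ih =>
    rw [sec]
    split_ifs
    · exact .inr ⟨_, rfl⟩
    · exact ih x

/-- A walker leaving `x` along an edge next leaves, if ever, the other end of that edge. -/
theorem isChain_sec (hd : 3 ≤ d) (w : List (Fin d)) (x : Fin d) :
    (sec w x).IsChain (fun i j => ¬(commGraph d).Adj i j) := by
  induction w generalizing x with
  | nil => simp [sec]
  | cons i w ih =>
    rw [sec]
    split_ifs with h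
    · have hc := ih (sw i x)
      rcases sec_eq_nil_or w (sw i x) with e | ⟨t, e⟩ <;> rw [e] at hc ⊢
      · simp
      · refine List.isChain_cons_cons.2 ⟨?_, hc⟩
        rw [commGraph_adj_iff hd]
        rcases h with rfl | rfl <;> simp
    · exact ih x

/-- Every letter moves both walkers, so they keep exchanging places along a common edge, which for
`d ≥ 3` can only be that of `i`. -/
theorem eq_of_length_sec (hd : 3 ≤ d) (w : List (Fin d)) (i : Fin d)
    (h₁ : (sec w i).length = w.length) (h₂ : (sec w (next i)).length = w.length) :
    ∀ j ∈ w, j = i := by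
  induction w with
  | nil => simp
  | cons j w ih =>
    have key : ∀ x, (sec (j :: w) x).length = (j :: w).length →
        (x = j ∨ x = next j) ∧ (sec w (sw j x)).length = w.length := by
      intro x hx
      rw [sec] at hx
      split_ifs at hx with h
      · exact ⟨h, by simpa using hx⟩
      · have := length_sec_le w x
        simp only [List.length_cons] at hx
        omega
    obtain ⟨c₁, h₁⟩ := key _ h₁
    obtain ⟨c₂, h₂⟩ := key _ h₂
    have hj : j = i := by
      rcases c₁ with c₁ | c₁
      · exact c₁.symm
      · rcases c₂ with c₂ | c₂
        · rw [← c₂] at c₁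
          exact absurd c₁.symm (next_next_ne hd i)
        · exact (next_injective c₂).symm
    subst hj
    simp only [sw, Equiv.swap_apply_left, Equiv.swap_apply_right] at h₁ h₂
    simpa using ih h₂ h₁

/-! ### Positive words acting trivially -/

/-- A nonempty positive word acts nontrivially. -/
theorem eq_nil_of_wordAct_eq (hd : 3 ≤ d) (w : List (Fin d)) (h : wordAct w = wordAct []) :
    w = [] := by
  induction hn : w.length using Nat.strong_induction_on generalizing w with
  | _ n IH =>
  have key : ∀ (i : Fin d) (w : List (Fin d)), (i :: w).length = n →
      wordAct (i :: w) = wordAct [] →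
      (sec (i :: w) i).length = n ∧ ∀ j ∈ i :: w, j = i := by
    intro i w hl h
    -- Sections of a trivially acting word act trivially, so by induction one that is shorter than
    -- the word is empty.
    have full : ∀ x, sec (i :: w) x ≠ [] → (sec (i :: w) x).length = (i :: w).length := by
      intro x hx
      by_contra hne
      have hle := length_sec_le (i :: w) x
      exact hx (IH _ (by omega) _ (wordAct_sec_eq h x) rfl)
    have f₁ := full i (by simp [sec])
    exact ⟨f₁.trans hl, eq_of_length_sec hd _ i f₁ (full (next i) (by simp [sec]))⟩
  match w, h, hn with
  | [], _, _ => rfl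
  | [i], h, _ =>
    have := dest_eq_of_wordAct_eq h i
    simp only [dest, sw, Equiv.swap_apply_left] at this
    exact absurd this (next_ne hd i)
  | i :: j :: w, h, hn =>
    obtain ⟨hl, hi⟩ := key i (j :: w) hn h
    obtain rfl : j = i := hi j (by simp)
    have hs := wordAct_sec_eq h j
    have e : sec (j :: j :: w) j = j :: next j :: sec w j := by simp [sec, sw]
    rw [e] at hs hl
    -- The word is a power of `j`, but its section at `j` is another trivially acting word of length
    -- `n`, and that one contains `next j` besides `j`.
    exact absurd ((key j _ hl hs).2 (next j) (by simp)) (next_ne hd j)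

/-! ### Trajectories determine traces -/

/-- The trajectory of a walker starting at `x`, including its final position. -/
def traj (w : List (Fin d)) (x : Fin d) : List (Fin d) := sec w x ++ [dest w x]

theorem traj_cons (i : Fin d) (w : List (Fin d)) (x : Fin d) :
    traj (i :: w) x = if x = i ∨ x = next i then x :: traj w (sw i x) else traj w x := by
  unfold traj
  rw [sec, dest]
  split_ifs with h
  · rfl
  · rw [sw_of_not h]

theorem exists_traj_eq_cons (w : List (Fin d)) (x : Fin d) : ∃ t, traj w x = x :: t := by
  induction w generalizing x with
  | nil => exact ⟨_, rfl⟩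
  | cons i w ih =>
    rw [traj_cons]
    split_ifs
    · exact ⟨_, rfl⟩
    · exact ih x

theorem traj_cons_injective {i : Fin d} {u v : List (Fin d)}
    (h : ∀ x, traj (i :: u) x = traj (i :: v) x) (x : Fin d) : traj u x = traj v x := by
  -- This walker stands at `x` once the letter `i` has acted.
  have := h (sw i x)
  rw [traj_cons, traj_cons, Equiv.swap_apply_self] at this
  split_ifs at this with hx
  · simpa using this
  · have e : sw i x = x := by simpa [sw] using (sw_of_not hx).symm
    rwa [e] at this

/-- The element of the trace monoid spelled by a word. -/
def tr (w : List (Fin d)) : TraceMonoid (commGraph d) :=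
  PresentedMonoid.mk _ (FreeMonoid.ofList w)

theorem tr_nil : tr ([] : List (Fin d)) = 1 := rfl

theorem tr_cons (i : Fin d) (w : List (Fin d)) :
    tr (i :: w) = PresentedMonoid.of (commRels (commGraph d)) i * tr w := rfl

theorem tr_append (u v : List (Fin d)) : tr (u ++ v) = tr u * tr v := rfl

theorem tr_surjective : Function.Surjective (tr : List (Fin d) → TraceMonoid (commGraph d)) := by
  intro x
  obtain ⟨w, rfl⟩ := PresentedMonoid.surjective_mk x
  exact ⟨FreeMonoid.toList w, rfl⟩

theorem tr_swap {i j : Fin d} (h : (commGraph d).Adj i j) (w : List (Fin d)) :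
    tr (i :: j :: w) = tr (j :: i :: w) := by
  have : PresentedMonoid.of (commRels (commGraph d)) i * PresentedMonoid.of _ j =
      PresentedMonoid.of _ j * PresentedMonoid.of _ i :=
    PresentedMonoid.mk_eq_mk_of_rel ⟨i, j, h, rfl, rfl⟩
  rw [tr_cons, tr_cons, tr_cons, tr_cons, ← mul_assoc, this, mul_assoc]

/-- Commuting letters have disjoint edges, so no walker is moved by both. -/
theorem traj_swap (hd : 3 ≤ d) {i j : Fin d} (h : (commGraph d).Adj i j) (w : List (Fin d))
    (x : Fin d) : traj (i :: j :: w) x = traj (j :: i :: w) x := by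
  obtain ⟨h₁, h₂, h₃⟩ := (commGraph_adj_iff hd i j).1 h
  have h₄ : next i ≠ next j := fun e => h₁ (next_injective e)
  by_cases hi : x = i ∨ x = next i
  · have hj : ¬(x = j ∨ x = next j) := by
      rcases hi with rfl | rfl <;> simp [h₁, h₂.symm, h₃, h₄]
    have hj' : ¬(sw i x = j ∨ sw i x = next j) := by
      rcases hi with rfl | rfl <;> simp [sw, h₁, h₂.symm, h₃, h₄]
    simp only [traj_cons, if_pos hi, if_neg hj, if_neg hj']
  · have hi' : x = j ∨ x = next j → ¬(sw j x = i ∨ sw j x = next i) := by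
      rintro (rfl | rfl) <;> simp [sw, h₁.symm, h₂, h₃.symm, h₄.symm]
    by_cases hj : x = j ∨ x = next j
    · simp only [traj_cons, if_pos hj, if_neg hi, if_neg (hi' hj)]
    · simp only [traj_cons, if_neg hj, if_neg hi]

/-- A letter moving both of its endpoints first can be commuted to the front of a word. -/
theorem exists_front (hd : 3 ≤ d) (i : Fin d) (v s t : List (Fin d))
    (h₁ : traj v i = i :: next i :: s) (h₂ : traj v (next i) = next i :: i :: t) :
    ∃ w, tr v = tr (i :: w) ∧ ∀ x, traj v x = traj (i :: w) x := by
  induction v with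
  | nil => simp [traj, sec, dest] at h₁
  | cons j v ih =>
    by_cases hji : j = i
    · subst hji
      exact ⟨v, rfl, fun _ => rfl⟩
    -- A first letter `j` whose edge meets that of `i` in one vertex would send a walker the wrong
    -- way; hence `j` commutes with `i`.
    have n₁ : i ≠ next j := by
      rintro rfl
      obtain ⟨r, hr⟩ := exists_traj_eq_cons v j
      simp [traj_cons, sw, hr] at h₁
      exact next_next_ne hd j h₁.1.symm
    have n₂ : j ≠ next i := by
      rintro rfl
      obtain ⟨r, hr⟩ := exists_traj_eq_cons v (next (next i))
      simp [traj_cons, sw, hr] at h₂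
      exact next_next_ne hd i h₂.1
    have n₃ : next i ≠ next j := fun e => hji (next_injective e).symm
    rw [traj_cons, if_neg (by simp [Ne.symm hji, n₁])] at h₁
    rw [traj_cons, if_neg (by simp [n₂.symm, n₃])] at h₂
    obtain ⟨w, hw, hw'⟩ := ih h₁ h₂
    have hadj : (commGraph d).Adj j i := (commGraph_adj_iff hd j i).2 ⟨hji, n₁, n₂⟩
    refine ⟨j :: w, ?_, fun x => ?_⟩
    · rw [tr_cons, hw, ← tr_cons, tr_swap hadj]
    · rw [← traj_swap hd hadj, traj_cons, traj_cons j (i :: w), hw', hw']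

/-- The trajectories of all walkers determine the trace of a word. -/
theorem tr_eq_of_traj_eq (hd : 3 ≤ d) (u v : List (Fin d)) (h : ∀ x, traj u x = traj v x) :
    tr u = tr v := by
  induction u generalizing v with
  | nil =>
    cases v with
    | nil => rfl
    | cons i v =>
      have := congrArg List.length (h i)
      simp [traj, sec] at this
  | cons i u ih =>
    obtain ⟨s, hs⟩ := exists_traj_eq_cons u (next i)
    obtain ⟨t, ht⟩ := exists_traj_eq_cons u i
    obtain ⟨w, hw, hw'⟩ := exists_front hd i v s t
      (by rw [← h, traj_cons]; simp [sw, hs]) (by rw [← h, traj_cons]; simp [sw, ht])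
    rw [hw, tr_cons, tr_cons, ih w (traj_cons_injective fun x => (h x).trans (hw' x))]

/-! ### Rigid words -/

/-- The congruence relating two words when they are equal or neither of them has all its pairs of
consecutive letters non-commuting. -/
def rigidCon (d : ℕ) : Con (FreeMonoid (Fin d)) where
  r u v := u.toList.IsChain (fun i j => ¬(commGraph d).Adj i j) ∨
    v.toList.IsChain (fun i j => ¬(commGraph d).Adj i j) → u = v
  iseqv :=
    { refl := fun _ _ => rfl
      symm := fun h h' => (h h'.symm).symm
      trans := by
        rintro u v w h₁ h₂ (h | h)
        · obtain rfl := h₁ (.inl h)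
          exact h₂ (.inl h)
        · obtain rfl := h₂ (.inr h)
          exact h₁ (.inr h) }
  mul' := by
    intro u v u' v' h₁ h₂ h
    simp only [FreeMonoid.toList_mul] at h
    rcases h with h | h
    · rw [h₁ (.inl h.left_of_append), h₂ (.inl h.right_of_append)]
    · rw [h₁ (.inr h.left_of_append), h₂ (.inr h.right_of_append)]

/-- Both sides of a defining relation contain a commuting pair, so `rigidCon` contains the presented
congruence. -/
theorem eq_of_tr_eq {u v : List (Fin d)} (h : tr u = tr v)
    (hu : u.IsChain (fun i j => ¬(commGraph d).Adj i j)) : u = v := by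
  have hle : conGen (commRels (commGraph d)) ≤ rigidCon d := by
    apply Con.conGen_le.2
    rintro _ _ ⟨p, q, hpq, rfl, rfl⟩ (h | h)
    · exact absurd hpq (by simpa using h)
    · exact absurd hpq.symm (by simpa using h)
  exact hle (PresentedMonoid.mk_eq_mk_iff.1 h) (.inl hu)

/-! ### Faithfulness of the action -/

/-- Words with the same action have the same trace. -/
theorem tr_eq_of_wordAct_eq (hd : 3 ≤ d) (u v : List (Fin d)) (h : wordAct u = wordAct v) :
    tr u = tr v := by
  induction hn : u.length + v.length using Nat.strong_induction_on generalizing u v with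
  | _ n IH =>
  refine tr_eq_of_traj_eq hd u v fun x => ?_
  have hs := wordAct_sec_eq h x
  suffices sec u x = sec v x by rw [traj, traj, this, dest_eq_of_wordAct_eq h x]
  rcases sec_eq_nil_or u x with hu | ⟨s, hu⟩
  · rw [hu] at hs ⊢
    exact (eq_nil_of_wordAct_eq hd _ hs.symm).symm
  rcases sec_eq_nil_or v x with hv | ⟨t, hv⟩
  · rw [hv] at hs ⊢
    exact eq_nil_of_wordAct_eq hd _ hs
  have lu := length_sec_le u x
  have lv := length_sec_le v x
  have cu := isChain_sec hd u x
  rw [hu] at hs lu cu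
  rw [hv] at hs lv
  simp only [List.length_cons] at lu lv
  -- Dropping the shared letter `x` makes the total length decrease even when the sections are as
  -- long as `u` and `v`.
  rw [hu, hv, eq_of_tr_eq (IH _ (by omega) s t (wordAct_cancel hs) rfl) cu.tail]

/-! ### From words to the group and its subsemigroup -/

theorem act_comm (hd : 3 ≤ d) {i j : Fin d} (h : (commGraph d).Adj i j) (u : List (Fin d)) :
    act j (act i u) = act i (act j u) := by
  obtain ⟨h₁, h₂, h₃⟩ := (commGraph_adj_iff hd i j).1 h
  have h₄ : next i ≠ next j := fun e => h₁ (next_injective e)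
  cases u with
  | nil => rfl
  | cons x v =>
    simp only [act]
    by_cases a₁ : x = i
    · subst a₁
      simp [h₁, h₂.symm, h₃, h₄, Equiv.swap_apply_of_ne_of_ne]
    by_cases a₂ : x = next i
    · subst a₂
      simp [a₁, h₁, h₂.symm, h₃, h₄, Equiv.swap_apply_of_ne_of_ne]
    by_cases a₃ : x = j
    · subst a₃
      simp [a₁, a₂, h₃.symm, h₄.symm, Equiv.swap_apply_of_ne_of_ne]
    by_cases a₄ : x = next j
    · subst a₄
      simp [a₁, a₂, a₃, h₁.symm, h₂, Equiv.swap_apply_of_ne_of_ne]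
    simp [a₁, a₂, a₃, a₄, Equiv.swap_apply_of_ne_of_ne]

theorem gen_comm (hd : 3 ≤ d) {i j : Fin d} (h : (commGraph d).Adj i j) :
    gen d i * gen d j = gen d j * gen d i :=
  Subtype.ext (TreeAut.ext' fun u => act_comm hd h u)

/-- The homomorphism from the trace monoid to `G_d` that sends generators to generators. -/
def toG (hd : 3 ≤ d) : TraceMonoid (commGraph d) →* G d :=
  PresentedMonoid.lift (gen d) (by
    rintro _ _ ⟨p, q, h, rfl, rfl⟩
    simpa using gen_comm hd h)

theorem toG_of (hd : 3 ≤ d) (i : Fin d) : toG hd (PresentedMonoid.of _ i) = gen d i :=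
  PresentedMonoid.lift_of ..

theorem toG_tr_apply (hd : 3 ≤ d) (w u : List (Fin d)) :
    (toG hd (tr w) : TreeAut (Fin d)) u = wordAct w u := by
  induction w generalizing u with
  | nil => rfl
  | cons i w ih =>
    rw [tr_cons, map_mul, toG_of]
    exact ih (act i u)

theorem wordAct_eq_of_toG_eq (hd : 3 ≤ d) {u v : List (Fin d)}
    (h : toG hd (tr u) = toG hd (tr v)) : wordAct u = wordAct v := by
  funext t
  rw [← toG_tr_apply hd, ← toG_tr_apply hd, h]

theorem toG_injective (hd : 3 ≤ d) : Function.Injective (toG hd) := by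
  intro x y h
  obtain ⟨u, rfl⟩ := tr_surjective x
  obtain ⟨v, rfl⟩ := tr_surjective y
  exact tr_eq_of_wordAct_eq hd u v (wordAct_eq_of_toG_eq hd h)

theorem tr_eq_one_iff (hd : 3 ≤ d) {w : List (Fin d)} : tr w = 1 ↔ w = [] := by
  refine ⟨fun h => eq_nil_of_wordAct_eq hd w (wordAct_eq_of_toG_eq hd ?_), fun h => h ▸ tr_nil⟩
  rw [h, tr_nil]

theorem toG_mem_closure (hd : 3 ≤ d) (i : Fin d) (w : List (Fin d)) :
    toG hd (tr (i :: w)) ∈ Subsemigroup.closure (Set.range (gen d)) := by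
  have hi (j : Fin d) : gen d j ∈ Subsemigroup.closure (Set.range (gen d)) :=
    Subsemigroup.subset_closure ⟨j, rfl⟩
  induction w generalizing i with
  | nil =>
    rw [tr_cons, tr_nil, mul_one, toG_of]
    exact hi i
  | cons j w ih =>
    rw [tr_cons, map_mul, toG_of]
    exact mul_mem (hi i) (ih j)

theorem mrange_toG (hd : 3 ≤ d) :
    MonoidHom.mrange (toG hd) = Submonoid.closure (Set.range (gen d)) := by
  apply le_antisymm
  · rintro _ ⟨x, rfl⟩
    obtain ⟨w, rfl⟩ := tr_surjective x
    cases w with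
    | nil => exact one_mem _
    | cons i w =>
      exact (Subsemigroup.closure_le (S := (Submonoid.closure (Set.range (gen d))).toSubsemigroup)).2
        Submonoid.subset_closure (toG_mem_closure hd i w)
  · rw [Submonoid.closure_le]
    rintro _ ⟨i, rfl⟩
    exact ⟨_, toG_of hd i⟩

theorem subsemigroup_closure_eq (hd : 3 ≤ d) :
    (Subsemigroup.closure (Set.range (gen d)) : Set (G d)) = {g | ∃ x, x ≠ 1 ∧ toG hd x = g} := by
  ext g
  constructor
  · intro hg
    induction hg using Subsemigroup.closure_induction with
    | mem g hg =>
      obtain ⟨i, rfl⟩ := hg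
      exact ⟨tr [i], fun h => by simpa using (tr_eq_one_iff hd).1 h, toG_of hd i⟩
    | mul g h _ _ hg hh =>
      obtain ⟨x, hx, rfl⟩ := hg
      obtain ⟨y, _, rfl⟩ := hh
      obtain ⟨u, rfl⟩ := tr_surjective x
      obtain ⟨v, rfl⟩ := tr_surjective y
      refine ⟨tr u * tr v, fun h => hx ?_, map_mul ..⟩
      rw [← tr_append, tr_eq_one_iff hd, List.append_eq_nil_iff] at h
      rw [h.1, tr_nil]
  · rintro ⟨x, hx, rfl⟩
    obtain ⟨w, rfl⟩ := tr_surjective x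
    cases w with
    | nil => exact absurd tr_nil hx
    | cons i w => exact toG_mem_closure hd i w

end Gd

theorem mainTheorem6 (d : ℕ) (hd : 3 ≤ d) (hodd : Odd d) :
    ∃ φ : TraceMonoid (Gd.commGraph d) ≃* Submonoid.closure (Set.range (Gd.gen d)),
      (∀ i : Fin d,
        ((φ (PresentedMonoid.of (commRels (Gd.commGraph d)) i) :
          Submonoid.closure (Set.range (Gd.gen d))) : Gd.G d) = Gd.gen d i) ∧
      (Subsemigroup.closure (Set.range (Gd.gen d)) : Set (Gd.G d)) =
        {g | ∃ x : TraceMonoid (Gd.commGraph d), x ≠ 1 ∧ (φ x : Gd.G d) = g} := by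
  refine ⟨(MulEquiv.ofBijective (Gd.toG hd).mrangeRestrict
      ⟨fun _ _ h => Gd.toG_injective hd (congrArg Subtype.val h),
        MonoidHom.mrangeRestrict_surjective _⟩).trans
    (MulEquiv.submonoidCongr (Gd.mrange_toG hd)), fun i => Gd.toG_of hd i, ?_⟩
  exact Gd.subsemigroup_closure_eq hd
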